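/- Let $A$ be a finite alphabet. A product $B_0^*a_1B_1^*\cdots a_kB_k^*$ (with $k\ge 0$, $a_i\in A$, $B_i\subseteq A$) has size $k$; it is called unambiguous if every word of it has exactly one factorization $x_0a_1x_1\cdots a_kx_k$ with $x_i\in B_i^*$ for all $i$. An unambiguous language is a finite disjoint union of unambiguous products. For $\kappa\in\mathbb N$ and $w,w'\in A^*$, write $w\equiv_\kappa w'$ if $w$ and $w'$ belong to the same unambiguous products of size at most $\kappa$. Let $\mathrm{UL}[\kappa]$ be the class of all languages that are unions of $\equiv_\kappa$-classes (equivalently, boolean combinations of unambiguous products of size at most $\kappa$), and let $\mathrm{UL}=\bigcup_{\kappa}\mathrm{UL}[\kappa]$. A language $L$ separates $L_1$ from $L_2$ if $L_1\subseteq L$ and $L_2\cap L=\varnothing$; $L_1$ and $L_2$ are $\mathcal C$-separable if some $L\in\mathcal C$ separates $L_1$ from $L_2$. A language $L\subseteq A^*$ is recognized by a monoid $M$ if $L=\alpha^{-1}(F)$ for some monoid morphism $\alpha:A^*\to M$ and some $F\subseteq M$. Theorem. Let $L_1,L_2\subseteq A^*$ be recognized by finite monoids $M_1$ and $M_2$ respectively,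 and let $\kappa=(2|M_1||M_2|+1)(|A|+1)^2$. The following are equivalent: (a) some unambiguous language separates $L_1$ from $L_2$; (a') $L_1$ and $L_2$ are $\mathrm{UL}$-separable; (b) $L_1$ and $L_2$ are $\mathrm{UL}[\kappa]$-separable; (c) the language $\{w\in A^*\mid \exists u\in L_1,\ u\equiv_\kappa w\}$ separates $L_1$ from $L_2$. -/

import Mathlib

/-- `L` is recognized by the monoid `M`: there are a morphism `α : A^* → M` and a subset
`F ⊆ M` with `L = α⁻¹(F)`. -/
def RecognizedBy {A : Type*} (L : Language A) (M : Type*) [Monoid M] : Prop :=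
  ∃ (α : FreeMonoid A →* M) (F : Set M), ∀ w : List A, w ∈ L ↔ α (FreeMonoid.ofList w) ∈ F

/-- A formal product `B₀* a₁ B₁* ⋯ aₖ Bₖ*`, given by the set `B₀` and the list
`(a₁, B₁), …, (aₖ, Bₖ)`. -/
@[ext] structure MarkedProduct (A : Type*) where
  /-- the set `B₀` -/
  first : Set A
  /-- the list `(a₁, B₁), …, (aₖ, Bₖ)` -/
  rest : List (A × Set A)

namespace MarkedProduct

variable {A : Type*}

/-- The size of `B₀* a₁ B₁* ⋯ aₖ Bₖ*` is `k`. -/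
def size (P : MarkedProduct A) : ℕ := P.rest.length

/-- `f = (x₀, [x₁, …, xₖ])` is a factorization witnessing that `w` belongs to
`B₀* a₁ B₁* ⋯ aₖ Bₖ*`: each `xᵢ` is a word over `Bᵢ`, and `w = x₀ a₁ x₁ ⋯ aₖ xₖ`. -/
def IsFactorization (P : MarkedProduct A) (f : List A × List (List A)) (w : List A) : Prop :=
  (∀ c ∈ f.1, c ∈ P.first) ∧
  List.Forall₂ (fun (p : A × Set A) (x : List A) => ∀ c ∈ x, c ∈ p.2) P.rest f.2 ∧
  w = f.1 ++ (List.zipWith (fun (p : A × Set A) (x : List A) => p.1 :: x) P.rest f.2).flatten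

/-- The language denoted by a product. -/
def language (P : MarkedProduct A) : Language A :=
  {w : List A | ∃ f, P.IsFactorization f w}

/-- A product is unambiguous if every word of its language has exactly one factorization. -/
def IsUnambiguous (P : MarkedProduct A) : Prop :=
  ∀ w ∈ P.language, ∃! f, P.IsFactorization f w

end MarkedProduct

/-- The class of finite disjoint unions of unambiguous products. -/
def unambiguousLanguages (A : Type*) : Set (Language A) :=
  {L | ∃ S : Set (MarkedProduct A), S.Finite ∧ (∀ P ∈ S, P.IsUnambiguous) ∧
    S.PairwiseDisjoint MarkedProduct.language ∧
    ∀ w : List A, w ∈ L ↔ ∃ P ∈ S, w ∈ P.language}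

/-- The relation `≡_κ`: two words are equivalent if they belong to the same unambiguous
products of size at most `κ`. -/
def ulSetoid (A : Type*) (κ : ℕ) : Setoid (List A) where
  r u v := ∀ P : MarkedProduct A, P.IsUnambiguous → P.size ≤ κ →
    (u ∈ P.language ↔ v ∈ P.language)
  iseqv :=
    ⟨fun _ _ _ _ => Iff.rfl, fun h P hP hs => (h P hP hs).symm,
      fun h₁ h₂ P hP hs => (h₁ P hP hs).trans (h₂ P hP hs)⟩

/-- `UL[κ]`: the class of languages that are unions of equivalence classes of `≡_κ`. -/
def ULIndex (A : Type*) (κ : ℕ) : Set (Language A) :=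
  {L | ∃ C : Set (Set (List A)), C ⊆ (ulSetoid A κ).classes ∧ ∀ w : List A, w ∈ L ↔ w ∈ ⋃₀ C}

/-- `UL`: the union of the classes `UL[κ]`. -/
def UL (A : Type*) : Set (Language A) := ⋃ κ : ℕ, ULIndex A κ

/-- The closure of `L` under `≡_κ`. -/
def ulClosure {A : Type*} (κ : ℕ) (L : Language A) : Language A :=
  {w : List A | ∃ u ∈ L, (ulSetoid A κ) u w}

/-- `L` separates `L₁` from `L₂`. -/
def Separates {A : Type*} (L L₁ L₂ : Language A) : Prop :=
  L₁ ≤ L ∧ L₂ ⊓ L = ⊥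

/-- `L₁` and `L₂` are `𝒞`-separable. -/
def SeparableBy {A : Type*} (𝒞 : Set (Language A)) (L₁ L₂ : Language A) : Prop :=
  ∃ L ∈ 𝒞, Separates L L₁ L₂

/-! Put `G = M₁ × M₂` and let `g u v` be the pair of images of `u` and `v`. The core is
`IsPairHom.exists_isCellFamily`: the words over `B` split into finitely many disjoint unambiguous
products (cells), none of which separates two words that agree on all small unambiguous products
over `B`. For `u`, `v` in one cell and every `k`, the value `g u v` is also taken by some
`≡_k`-equivalent pair. So if a cell meets both `L₁` and `L₂`, no language of any `UL[k]` separates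
them; if none does, the union of the cells meeting `L₁` is an unambiguous separator. The bound `κ`
concerns saturation of the cells, not their size.

Cells are built by induction on the number of letters. Run through `B` `|G|` times from the left,
cutting at the first occurrence of the current letter, then `|G|` times from the right, cutting at
last occurrences. Pieces cut off, and remainders in which the current letter no longer occurs, miss
a letter and fall under the induction hypothesis. If all cuts succeed, the middle is left as an
arbitrary word over `B`.

The middle needs no refinement because, by pigeonhole in `G`, the value of each side contains a
factor that can be repeated at will, realized by `≡_k`-equivalent words using every letter of `B`.
Between high powers of words with the same letters an unambiguous product is blind
(`IsUnambiguous.mem_of_wpow`): a marker strictly between two unmarked copies would give a repeated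
middle two factorizations. -/

namespace MarkedProduct

variable {A : Type*}

/-! ### Counting factorizations -/

open Classical in
/-- The number of factorizations of a word in the product `⟨B, r⟩`, computed letter by letter. -/
noncomputable def runs : Set A → List (A × Set A) → List A → ℕ
  | _, [], [] => 1
  | _, _ :: _, [] => 0
  | B, [], c :: w => if c ∈ B then runs B [] w else 0
  | B, (a, C) :: r, c :: w =>
      (if c ∈ B then runs B ((a, C) :: r) w else 0) + (if a = c then runs C r w else 0)

/-- The first letter either belongs to `x₀` or is the first marker with `x₀` empty; the two cases
are disjoint injective images. Membership and unambiguity thereby become the inequalities `1 ≤ runs`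
and `runs ≤ 1`. -/
theorem encard_factorizations (w : List A) : ∀ (B : Set A) (r : List (A × Set A)),
    {f | (MarkedProduct.mk B r).IsFactorization f w}.encard = runs B r w := by
  have hinj (c : A) : Function.Injective
      (fun f : List A × List (List A) => (c :: f.1, f.2)) := by
    rintro ⟨x, xs⟩ ⟨y, ys⟩ h
    simpa using h
  have hinj' : Function.Injective
      (fun f : List A × List (List A) => (([] : List A), f.1 :: f.2)) := by
    rintro ⟨x, xs⟩ ⟨y, ys⟩ h
    simpa using h
  induction w with
  | nil =>
    rintro B (_ | ⟨⟨a, C⟩, r⟩)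
    · have : {f | (MarkedProduct.mk B []).IsFactorization f []} = {([], [])} := by
        ext ⟨x, xs⟩
        cases xs <;> simp [IsFactorization]
        rintro rfl; simp
      rw [this]; simp [runs]
    · have : {f | (MarkedProduct.mk B ((a, C) :: r)).IsFactorization f []} = ∅ := by
        ext ⟨x, xs⟩
        cases xs <;> simp [IsFactorization]
      rw [this]; simp [runs]
  | cons c w ih =>
    have hstay (B : Set A) (hc : c ∈ B) (r : List (A × Set A)) (x xs) :
        (MarkedProduct.mk B r).IsFactorization (c :: x, xs) (c :: w) ↔
          (MarkedProduct.mk B r).IsFactorization (x, xs) w := by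
      simp [IsFactorization, hc]
    rintro B (_ | ⟨⟨a, C⟩, r⟩)
    · by_cases hc : c ∈ B
      · have : {f | (MarkedProduct.mk B []).IsFactorization f (c :: w)} =
            (fun f : List A × List (List A) => (c :: f.1, f.2)) ''
              {f | (MarkedProduct.mk B []).IsFactorization f w} := by
          ext ⟨x, xs⟩
          cases x with
          | nil => cases xs <;> simp [IsFactorization]
          | cons d x =>
            simp only [Set.mem_ofPred_eq, Set.mem_image, Prod.mk.injEq, List.cons.injEq, Prod.exists]
            constructor
            · intro h
              have : c = d := by
                have := h.2.2; simp at this; exact this.1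
              subst this
              exact ⟨x, xs, (hstay B hc [] x xs).1 h, ⟨rfl, rfl⟩, rfl⟩
            · rintro ⟨x, xs, h, ⟨rfl, rfl⟩, rfl⟩
              exact (hstay B hc [] x xs).2 h
        rw [this, (hinj c).encard_image, ih]; simp [runs, hc]
      · have : {f | (MarkedProduct.mk B []).IsFactorization f (c :: w)} = ∅ := by
          ext ⟨x, xs⟩
          cases xs <;> simp [IsFactorization]
          rintro h rfl; exact hc (h c (by simp))
        rw [this]; simp [runs, hc]
    · have : {f | (MarkedProduct.mk B ((a, C) :: r)).IsFactorization f (c :: w)} =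
          {f | c ∈ B ∧ f ∈ (fun f : List A × List (List A) => (c :: f.1, f.2)) ''
            {f | (MarkedProduct.mk B ((a, C) :: r)).IsFactorization f w}} ∪
          {f | a = c ∧ f ∈ (fun f : List A × List (List A) => (([] : List A), f.1 :: f.2)) ''
            {f | (MarkedProduct.mk C r).IsFactorization f w}} := by
        ext ⟨x, xs⟩
        cases x with
        | nil => cases xs with
          | nil => simp [IsFactorization]
          | cons y ys =>
            simp [IsFactorization]
            grind
        | cons d x =>
          simp only [Set.mem_ofPred_eq, Set.mem_image, Prod.mk.injEq, List.cons.injEq, Prod.exists,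
            Set.mem_union, reduceCtorEq, false_and, and_false, exists_false, or_false]
          constructor
          · intro h
            have hd : c = d := by
              have := h.2.2; simp at this; exact this.1
            subst hd
            have hc : c ∈ B := h.1 c (by simp)
            exact ⟨hc, x, xs, (hstay B hc _ x xs).1 h, ⟨rfl, rfl⟩, rfl⟩
          · rintro ⟨hc, x, xs, h, ⟨rfl, rfl⟩, rfl⟩
            exact (hstay B hc _ x xs).2 h
      rw [this, Set.encard_union_eq]
      · have h1 := (hinj c).encard_image
          {f | (MarkedProduct.mk B ((a, C) :: r)).IsFactorization f w}
        have h2 := hinj'.encard_image {f | (MarkedProduct.mk C r).IsFactorization f w}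
        rw [ih] at h1 h2
        generalize (_ '' {f | (MarkedProduct.mk B ((a, C) :: r)).IsFactorization f w}) = S at h1 ⊢
        generalize (_ '' {f | (MarkedProduct.mk C r).IsFactorization f w}) = S' at h2 ⊢
        by_cases hc : c ∈ B <;> by_cases ha : a = c <;> simp [runs, hc, ha, h1, h2]
      · rw [Set.disjoint_left]
        rintro _ ⟨-, f, -, rfl⟩ ⟨-, f', -, h⟩
        simp at h

theorem mem_language_iff_runs (P : MarkedProduct A) (w : List A) :
    w ∈ P.language ↔ 1 ≤ runs P.first P.rest w := by
  have h := encard_factorizations w P.first P.rest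
  have h1 : w ∈ P.language ↔ {f | P.IsFactorization f w}.Nonempty := Iff.rfl
  rw [h1, ← Set.one_le_encard_iff_nonempty]
  change 1 ≤ Set.encard {f | (MarkedProduct.mk P.first P.rest).IsFactorization f w} ↔ _
  rw [h]
  exact_mod_cast Iff.rfl

theorem isUnambiguous_iff_runs (P : MarkedProduct A) :
    P.IsUnambiguous ↔ ∀ w, runs P.first P.rest w ≤ 1 := by
  have h (w) : {f | P.IsFactorization f w}.encard ≤ 1 ↔ runs P.first P.rest w ≤ 1 := by
    have h := encard_factorizations w P.first P.rest
    change Set.encard {f | (MarkedProduct.mk P.first P.rest).IsFactorization f w} ≤ 1 ↔ _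
    rw [h]
    exact_mod_cast Iff.rfl
  simp_rw [← h, Set.encard_le_one_iff]
  constructor
  · intro hP w f g hf hg
    exact (hP w ⟨f, hf⟩).unique hf hg
  · rintro hP w ⟨f, hf⟩
    exact ⟨f, hf, fun g hg => hP w g f hg hf⟩

theorem isUnambiguous_iff (P : MarkedProduct A) :
    P.IsUnambiguous ↔ ∀ w f g, P.IsFactorization f w → P.IsFactorization g w → f = g :=
  ⟨fun hP w f _ hf hg => (hP w ⟨f, hf⟩).unique hf hg,
    fun hP w ⟨f, hf⟩ => ⟨f, hf, fun g hg => hP w g f hg hf⟩⟩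

/-- The last of the sets of the product `⟨B, r⟩`. -/
def endSet : Set A → List (A × Set A) → Set A
  | B, [] => B
  | _, (_, C) :: r => endSet C r

theorem runs_nil_pos {B : Set A} {w : List A} : 1 ≤ runs B [] w ↔ ∀ c ∈ w, c ∈ B := by
  induction w with
  | nil => simp [runs]
  | cons c w ih =>
    by_cases hc : c ∈ B
    · simpa [runs, hc] using ih
    · simp [runs, hc]

/-- A factorization of `u ++ v` crosses the cut after a definite number `i` of markers, and the
`i`-th set is shared by both sides. -/
theorem runs_append (u v : List A) : ∀ (B : Set A) (r : List (A × Set A)),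
    runs B r (u ++ v) = ∑ i ∈ Finset.range (r.length + 1),
      runs B (r.take i) u * runs (endSet B (r.take i)) (r.drop i) v := by
  induction u with
  | nil =>
    intro B r
    rw [Finset.sum_range_succ', Finset.sum_eq_zero]
    · simp [runs, endSet]
    · intro i hi
      cases r <;> simp_all [runs]
  | cons c u ih =>
    rintro B (_ | ⟨⟨a, C⟩, r⟩)
    · by_cases hc : c ∈ B <;> simp [runs, endSet, hc, ih]
    · rw [List.length_cons, Finset.sum_range_succ']
      have h1 := ih B ((a, C) :: r)
      rw [List.length_cons, Finset.sum_range_succ'] at h1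
      have h2 := ih C r
      simp only [List.take_succ_cons, List.drop_succ_cons, List.take_zero, List.drop_zero,
        endSet, runs, List.cons_append, add_mul, Finset.sum_add_distrib] at h1 h2 ⊢
      rw [h1, h2]
      by_cases hc : c ∈ B <;> by_cases ha : a = c <;> simp [hc, ha] <;> ring

theorem runs_mul_le (B : Set A) (r s : List (A × Set A)) (u v : List A) :
    runs B r u * runs (endSet B r) s v ≤ runs B (r ++ s) (u ++ v) := by
  rw [runs_append]
  have := Finset.single_le_sum (f := fun i => runs B ((r ++ s).take i) u *
    runs (endSet B ((r ++ s).take i)) ((r ++ s).drop i) v) (fun _ _ => Nat.zero_le _)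
    (show r.length ∈ Finset.range ((r ++ s).length + 1) by simp)
  simpa using this

theorem exists_cut {B : Set A} {r : List (A × Set A)} {u v : List A}
    (h : 1 ≤ runs B r (u ++ v)) : ∃ s t, r = s ++ t ∧ 1 ≤ runs B s u ∧
      1 ≤ runs (endSet B s) t v := by
  rw [runs_append] at h
  obtain ⟨i, -, hi⟩ := Finset.exists_ne_zero_of_sum_ne_zero (Nat.one_le_iff_ne_zero.1 h)
  exact ⟨r.take i, r.drop i, by simp, Nat.one_le_iff_ne_zero.2 (left_ne_zero_of_mul hi),
    Nat.one_le_iff_ne_zero.2 (right_ne_zero_of_mul hi)⟩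

theorem one_le_runs_append {B : Set A} {s t : List (A × Set A)} {u v : List A}
    (hu : 1 ≤ runs B s u) (hv : 1 ≤ runs (endSet B s) t v) : 1 ≤ runs B (s ++ t) (u ++ v) :=
  (Nat.mul_pos hu hv).trans_le (runs_mul_le B s t u v)

/-- Either copy of `z` can carry all the markers, the other being absorbed by the first or the last
set. The two ways cross the cut after `0` and `r.length` markers, hence differ. -/
theorem two_le_runs_append_self {B : Set A} {r : List (A × Set A)} {z : List A} (hr : r ≠ [])
    (h : 1 ≤ runs B r z) (hB : ∀ c ∈ z, c ∈ B) (hE : ∀ c ∈ z, c ∈ endSet B r) :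
    2 ≤ runs B r (z ++ z) := by
  have h1 := runs_nil_pos.2 hB
  have h2 := runs_nil_pos.2 hE
  rw [runs_append]
  have hl : 0 ≠ r.length := by simpa [eq_comm] using hr
  have := Finset.add_le_sum (f := fun i => runs B (r.take i) z *
    runs (endSet B (r.take i)) (r.drop i) z) (s := Finset.range (r.length + 1))
    (fun _ _ => Nat.zero_le _) (show 0 ∈ _ by simp) (show r.length ∈ _ by simp) hl
  simp only [List.take_zero, List.drop_zero, List.take_length, List.drop_length, endSet] at this
  nlinarith

/-! ### Blindness of unambiguous products between powers -/

/-- The `N`-th power of a word. -/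
abbrev wpow (T : List A) (N : ℕ) : List A := (List.replicate N T).flatten

theorem wpow_add (T : List A) (m n : ℕ) : wpow T (m + n) = wpow T m ++ wpow T n := by
  rw [wpow, List.replicate_add, List.flatten_append]

theorem wpow_one (T : List A) : wpow T 1 = T := by simp [wpow]

theorem mem_of_mem_wpow {T : List A} {N : ℕ} {c : A} (h : c ∈ wpow T N) : c ∈ T := by
  simp only [wpow, List.mem_flatten, List.mem_replicate] at h
  obtain ⟨_, ⟨-, rfl⟩, h⟩ := h
  exact h

theorem endSet_append (B : Set A) (s t : List (A × Set A)) :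
    endSet B (s ++ t) = endSet (endSet B s) t := by
  induction s generalizing B with
  | nil => rfl
  | cons p s ih => exact ih _

/-- There are fewer markers than copies of `T`, so some copy contains no marker and lies within a
single set. -/
theorem exists_unmarked_left (T v : List A) (N : ℕ) : ∀ {B : Set A} {r : List (A × Set A)},
    r.length < N → 1 ≤ runs B r (wpow T N ++ v) →
    ∃ s t m n, r = s ++ t ∧ N = m + 1 + n ∧ 1 ≤ runs B s (wpow T m) ∧
      (∀ c ∈ T, c ∈ endSet B s) ∧ 1 ≤ runs (endSet B s) t (wpow T n ++ v) := by
  induction N with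
  | zero => intro B r hr; simp at hr
  | succ N ih =>
    intro B r hr h
    rw [add_comm, wpow_add, wpow_one, List.append_assoc] at h
    obtain ⟨s, t, rfl, hs, ht⟩ := exists_cut h
    by_cases hs0 : s = []
    · subst hs0
      exact ⟨[], t, 0, N, rfl, by omega, by simp [wpow, runs], runs_nil_pos.1 hs, ht⟩
    · have := List.length_pos_iff.2 hs0
      obtain ⟨s', t', m, n, rfl, rfl, h1, h2, h3⟩ := ih (by simp at hr; omega) ht
      have he := endSet_append B s s'
      refine ⟨s ++ s', t', 1 + m, n, by simp, by omega, ?_, he ▸ h2, he ▸ h3⟩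
      rw [wpow_add, wpow_one]
      exact one_le_runs_append hs h1

theorem exists_unmarked_right (u T : List A) (N : ℕ) : ∀ {B : Set A} {r : List (A × Set A)},
    r.length < N → 1 ≤ runs B r (u ++ wpow T N) →
    ∃ s t m n, r = s ++ t ∧ N = m + 1 + n ∧ 1 ≤ runs B s (u ++ wpow T m) ∧
      (∀ c ∈ T, c ∈ endSet B s) ∧ 1 ≤ runs (endSet B s) t (wpow T n) := by
  induction N with
  | zero => intro B r hr; simp at hr
  | succ N ih =>
    intro B r hr h
    rw [wpow_add, wpow_one, ← List.append_assoc] at h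
    obtain ⟨s, t, rfl, hs, ht⟩ := exists_cut h
    by_cases ht0 : t = []
    · subst ht0
      exact ⟨s, [], N, 0, rfl, by omega, hs, runs_nil_pos.1 ht, by simp [wpow, runs]⟩
    · have := List.length_pos_iff.2 ht0
      obtain ⟨s', t', m, n, rfl, rfl, h1, h2, h3⟩ := ih (by simp at hr; omega) hs
      refine ⟨s', t' ++ t, m, n + 1, by simp, by omega, h1, h2, ?_⟩
      rw [wpow_add, wpow_one]
      exact one_le_runs_append h3 (by rwa [endSet_append] at ht)

/-- Between high powers of words with the same letters, an unambiguous product does not see the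
word in the middle. -/
theorem IsUnambiguous.mem_of_wpow {P : MarkedProduct A} (hP : P.IsUnambiguous)
    {N : ℕ} (hN : P.size < N) {T T' X Y : List A} (hTT' : ∀ c, c ∈ T ↔ c ∈ T')
    (hX : ∀ c ∈ X, c ∈ T) (hY : ∀ c ∈ Y, c ∈ T)
    (h : wpow T N ++ X ++ wpow T' N ∈ P.language) :
    wpow T N ++ Y ++ wpow T' N ∈ P.language := by
  obtain ⟨B, r⟩ := P
  rw [isUnambiguous_iff_runs] at hP
  rw [mem_language_iff_runs] at h ⊢
  simp only [size] at *
  rw [List.append_assoc] at h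
  obtain ⟨r₁, r₂, m, n, rfl, hN₁, h₁, hT, h₂⟩ := exists_unmarked_left T _ N hN h
  rw [← List.append_assoc] at h₂
  obtain ⟨r₃, r₄, m', n', rfl, hN₂, h₃, hT', h₄⟩ := exists_unmarked_right _ T' N
    (by simp at hN; omega) h₂
  have hz : ∀ c ∈ wpow T n ++ X ++ wpow T' m', c ∈ T := by
    intro c hc
    simp only [List.mem_append] at hc
    rcases hc with (hc | hc) | hc
    · exact mem_of_mem_wpow hc
    · exact hX c hc
    · exact (hTT' c).2 (mem_of_mem_wpow hc)
  -- `r₃` collects the markers between the unmarked copies of `T` and `T'`. If there are none, one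
  -- set absorbs everything in between, and `X` can be exchanged for `Y`; otherwise doubling the
  -- middle contradicts unambiguity.
  by_cases hr₃ : r₃ = []
  · subst hr₃
    have hTN : wpow T N = wpow T m ++ T ++ wpow T n := by
      rw [hN₁, wpow_add, wpow_add, wpow_one]
    have hTN' : wpow T' N = wpow T' m' ++ T' ++ wpow T' n' := by
      rw [hN₂, wpow_add, wpow_add, wpow_one]
    rw [hTN, hTN']
    have hmid : 1 ≤ runs (endSet B r₁) [] (T ++ (wpow T n ++ (Y ++ (wpow T' m' ++ T')))) := by
      rw [runs_nil_pos]
      intro c hc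
      apply hT
      simp only [List.mem_append] at hc
      rcases hc with hc | hc | hc | hc | hc
      · exact hc
      · exact mem_of_mem_wpow hc
      · exact hY c hc
      · exact (hTT' c).2 (mem_of_mem_wpow hc)
      · exact (hTT' c).2 hc
    have := one_le_runs_append h₁ (one_le_runs_append hmid h₄)
    simpa [List.append_assoc] using this
  · have h2 := two_le_runs_append_self hr₃ h₃ (fun c hc => hT c (hz c hc))
      (fun c hc => hT' c ((hTT' c).1 (hz c hc)))
    have h5 := (Nat.mul_le_mul h2 h₄).trans (runs_mul_le _ _ _ _ _)
    have h6 := (Nat.mul_le_mul h₁ h5).trans (runs_mul_le _ _ _ _ _)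
    have := h6.trans (hP _)
    omega

end MarkedProduct

/-! ### `≡_k` is a congruence -/

section

open MarkedProduct

variable {A : Type*}

theorem ulSetoid_of_imp {k : ℕ} {u v : List A}
    (h : ∀ P : MarkedProduct A, P.IsUnambiguous → P.size ≤ k → u ∈ P.language → v ∈ P.language)
    (h' : ∀ P : MarkedProduct A, P.IsUnambiguous → P.size ≤ k → v ∈ P.language → u ∈ P.language) :
    ulSetoid A k u v := fun P hP hk => ⟨h P hP hk, h' P hP hk⟩

/-- Cutting a product at the boundary of `u` and `u'` leaves two unambiguous products: counts
multiply to at most `1`, and each half has a word with count at least `1`, which bounds the counts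
of the other half. -/
theorem ulSetoid_append {k : ℕ} {u v u' v' : List A} (h : ulSetoid A k u v)
    (h' : ulSetoid A k u' v') : ulSetoid A k (u ++ u') (v ++ v') := by
  have key : ∀ {u v u' v' : List A}, ulSetoid A k u v → ulSetoid A k u' v' →
      ∀ P : MarkedProduct A, P.IsUnambiguous → P.size ≤ k → u ++ u' ∈ P.language →
        v ++ v' ∈ P.language := by
    rintro u v u' v' h h' ⟨B, r⟩ hP hk hu
    rw [isUnambiguous_iff_runs] at hP
    rw [mem_language_iff_runs] at hu ⊢
    simp only [size] at *
    obtain ⟨s, t, rfl, hs, ht⟩ := exists_cut hu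
    have hle : ∀ w w', runs B s w * runs (endSet B s) t w' ≤ 1 :=
      fun w w' => (runs_mul_le B s t w w').trans (hP _)
    simp only [List.length_append] at hk
    have hs' := (h ⟨B, s⟩ ((isUnambiguous_iff_runs _).2 fun w =>
      (Nat.le_mul_of_pos_right _ ht).trans (hle w u')) (by simp only [size]; omega)).1
      ((mem_language_iff_runs _ _).2 hs)
    have ht' := (h' ⟨endSet B s, t⟩ ((isUnambiguous_iff_runs _).2 fun w =>
      (Nat.le_mul_of_pos_left _ hs).trans (hle u w)) (by simp only [size]; omega)).1
      ((mem_language_iff_runs _ _).2 ht)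
    exact one_le_runs_append ((mem_language_iff_runs _ _).1 hs') ((mem_language_iff_runs _ _).1 ht')
  exact ulSetoid_of_imp (key h h') (key ((ulSetoid A k).symm h) ((ulSetoid A k).symm h'))

theorem ulSetoid_wpow {k : ℕ} {u v : List A} (h : ulSetoid A k u v) (N : ℕ) :
    ulSetoid A k (wpow u N) (wpow v N) := by
  induction N with
  | zero => exact (ulSetoid A k).refl _
  | succ N ih =>
    rw [wpow_add, wpow_add, wpow_one, wpow_one]
    exact ulSetoid_append ih h

theorem ulSetoid_wpow_append_wpow {k N : ℕ} (hN : k < N) {T₁ T₂ T₁' T₂' X₁ X₂ : List A}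
    (hT : ulSetoid A k T₁ T₂) (hT' : ulSetoid A k T₁' T₂')
    (hTT' : ∀ c, c ∈ T₁ ↔ c ∈ T₁') (h₁ : ∀ c ∈ X₁, c ∈ T₁) (h₂ : ∀ c ∈ X₂, c ∈ T₁) :
    ulSetoid A k (wpow T₁ N ++ X₁ ++ wpow T₁' N) (wpow T₂ N ++ X₂ ++ wpow T₂' N) :=
  (ulSetoid A k).trans
    (ulSetoid_of_imp (fun _ hP hk => hP.mem_of_wpow (hk.trans_lt hN) hTT' h₁ h₂)
      (fun _ hP hk => hP.mem_of_wpow (hk.trans_lt hN) hTT' h₂ h₁))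
    (ulSetoid_append (ulSetoid_append (ulSetoid_wpow hT N) ((ulSetoid A k).refl _))
      (ulSetoid_wpow hT' N))

end

/-! ### Joining two products by a marker -/

namespace MarkedProduct

variable {A : Type*}

/-- The product `P b Q`. -/
def concat (P : MarkedProduct A) (b : A) (Q : MarkedProduct A) : MarkedProduct A :=
  ⟨P.first, P.rest ++ (b, Q.first) :: Q.rest⟩

theorem size_concat (P Q : MarkedProduct A) (b : A) :
    (P.concat b Q).size = P.size + Q.size + 1 := by
  simp [concat, size]; omega

theorem isFactorization_concat {P Q : MarkedProduct A} {b : A} {h : List A × List (List A)}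
    {w : List A} : (P.concat b Q).IsFactorization h w ↔ ∃ x y f g, w = x ++ b :: y ∧
      P.IsFactorization f x ∧ Q.IsFactorization g y ∧ h = (f.1, f.2 ++ g.1 :: g.2) := by
  constructor
  · obtain ⟨x₀, xs⟩ := h
    rintro ⟨h₁, h₂, h₃⟩
    simp only [concat] at h₁ h₂ h₃
    obtain ⟨l₁, l₂, hl₁, hl₂, rfl⟩ : ∃ l₁ l₂, List.Forall₂
        (fun (p : A × Set A) (x : List A) => ∀ c ∈ x, c ∈ p.2) P.rest l₁ ∧ List.Forall₂
        (fun (p : A × Set A) (x : List A) => ∀ c ∈ x, c ∈ p.2) ((b, Q.first) :: Q.rest) l₂ ∧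
        xs = l₁ ++ l₂ :=
      ⟨_, _, by simpa using List.forall₂_take P.rest.length h₂,
        by simpa using List.forall₂_drop P.rest.length h₂, by simp⟩
    rw [List.forall₂_cons_left_iff] at hl₂
    obtain ⟨y₀, ys, hy₀, hys, rfl⟩ := hl₂
    refine ⟨_, _, (x₀, l₁), (y₀, ys), ?_, ⟨h₁, hl₁, rfl⟩, ⟨hy₀, hys, rfl⟩, rfl⟩
    rw [h₃, List.zipWith_append hl₁.length_eq]
    simp
  · rintro ⟨x, y, f, g, rfl, ⟨f₁, f₂, rfl⟩, ⟨g₁, g₂, rfl⟩, rfl⟩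
    refine ⟨f₁, List.rel_append f₂ (List.Forall₂.cons g₁ g₂), ?_⟩
    simp only [concat]
    rw [List.zipWith_append f₂.length_eq]
    simp

theorem mem_language_concat {P Q : MarkedProduct A} {b : A} {w : List A} :
    w ∈ (P.concat b Q).language ↔
      ∃ x y, w = x ++ b :: y ∧ x ∈ P.language ∧ y ∈ Q.language := by
  constructor
  · rintro ⟨h, hh⟩
    obtain ⟨x, y, f, g, rfl, hf, hg, -⟩ := isFactorization_concat.1 hh
    exact ⟨x, y, rfl, ⟨f, hf⟩, ⟨g, hg⟩⟩
  · rintro ⟨x, y, rfl, ⟨f, hf⟩, ⟨g, hg⟩⟩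
    exact ⟨_, isFactorization_concat.2 ⟨x, y, f, g, rfl, hf, hg, rfl⟩⟩

theorem IsUnambiguous.concat {P Q : MarkedProduct A} (hP : P.IsUnambiguous)
    (hQ : Q.IsUnambiguous) {b : A}
    (h : ∀ x ∈ P.language, ∀ x' ∈ P.language, ∀ y ∈ Q.language, ∀ y' ∈ Q.language,
      x ++ b :: y = x' ++ b :: y' → x = x' ∧ y = y') : (P.concat b Q).IsUnambiguous := by
  rw [isUnambiguous_iff] at *
  intro w h₁ h₂ hh₁ hh₂
  obtain ⟨x, y, f, g, rfl, hf, hg, rfl⟩ := isFactorization_concat.1 hh₁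
  obtain ⟨x', y', f', g', hw, hf', hg', rfl⟩ := isFactorization_concat.1 hh₂
  obtain ⟨rfl, rfl⟩ := h x ⟨f, hf⟩ x' ⟨f', hf'⟩ y ⟨g, hg⟩ y' ⟨g', hg'⟩ hw
  rw [hP _ _ _ hf hf', hQ _ _ _ hg hg']

theorem mem_language_nil {B : Set A} {w : List A} :
    w ∈ (MarkedProduct.mk B []).language ↔ ∀ c ∈ w, c ∈ B := by
  rw [mem_language_iff_runs, runs_nil_pos]

theorem isUnambiguous_nil (B : Set A) : (MarkedProduct.mk B []).IsUnambiguous := by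
  rw [isUnambiguous_iff]
  rintro w ⟨x, xs⟩ ⟨y, ys⟩ ⟨-, h₁, rfl⟩ ⟨-, h₂, h₃⟩
  cases h₁
  cases h₂
  simpa using h₃

end MarkedProduct

/-! ### Cutting at the first or last occurrence of a letter -/

section

open MarkedProduct

variable {A : Type*}

theorem append_cons_inj_left {b : A} {x x' y y' : List A} (hx : b ∉ x) (hx' : b ∉ x')
    (h : x ++ b :: y = x' ++ b :: y') : x = x' ∧ y = y' := by
  induction x generalizing x' with
  | nil =>
    cases x' with
    | nil => simpa using h
    | cons d x' =>
      simp only [List.nil_append, List.cons_append, List.cons.injEq] at h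
      exact absurd (by simp [h.1]) hx'
  | cons c x ih =>
    cases x' with
    | nil =>
      simp only [List.nil_append, List.cons_append, List.cons.injEq] at h
      exact absurd (by simp [h.1]) hx
    | cons d x' =>
      simp only [List.cons_append, List.cons.injEq, List.mem_cons, not_or] at h hx hx'
      obtain ⟨rfl, h⟩ := h
      obtain ⟨rfl, rfl⟩ := ih hx.2 hx'.2 h
      exact ⟨rfl, rfl⟩

theorem append_cons_inj_right {b : A} {x x' y y' : List A} (hy : b ∉ y) (hy' : b ∉ y')
    (h : x ++ b :: y = x' ++ b :: y') : x = x' ∧ y = y' := by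
  have h' := congrArg List.reverse h
  simp only [List.reverse_append, List.reverse_cons, List.append_assoc, List.singleton_append]
    at h'
  have := append_cons_inj_left (by simpa using hy) (by simpa using hy') h'
  simpa [and_comm] using this

/-- `w₁` and `w₂` belong to the same unambiguous products of size at most `κ` among those that
denote languages of words over `B`. -/
def ULEquivOn (κ : ℕ) (B : Set A) (w₁ w₂ : List A) : Prop :=
  ∀ P : MarkedProduct A, P.IsUnambiguous → P.size ≤ κ → (∀ w ∈ P.language, ∀ c ∈ w, c ∈ B) →
    (w₁ ∈ P.language ↔ w₂ ∈ P.language)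

theorem ULEquivOn.mono {κ κ' : ℕ} {B B' : Set A} {w₁ w₂ : List A} (h : ULEquivOn κ B w₁ w₂)
    (hκ : κ' ≤ κ) (hB : B' ⊆ B) : ULEquivOn κ' B' w₁ w₂ :=
  fun P hP hs hl => h P hP (hs.trans hκ) fun w hw c hc => hB (hl w hw c hc)

/-- A product `P` testing the prefix extends to `P b B*`, and one testing the suffix to `(B \ {b})*
b P`. The marker `b` must be the first `b` of the word, so unambiguity survives, at the cost of one
unit of size. -/
theorem ULEquivOn.left {κ : ℕ} {B : Set A} {b : A} (hb : b ∈ B) {x₁ x₂ y₁ y₂ : List A}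
    (h : ULEquivOn (κ + 1) B (x₁ ++ b :: y₁) (x₂ ++ b :: y₂))
    (hx₁ : ∀ c ∈ x₁, c ∈ B \ {b}) (hx₂ : ∀ c ∈ x₂, c ∈ B \ {b})
    (hy₁ : ∀ c ∈ y₁, c ∈ B) (hy₂ : ∀ c ∈ y₂, c ∈ B) :
    ULEquivOn κ (B \ {b}) x₁ x₂ ∧ ULEquivOn κ B y₁ y₂ := by
  have hn {x : List A} (hx : ∀ c ∈ x, c ∈ B \ {b}) : b ∉ x := fun h => (hx b h).2 rfl
  constructor
  · intro P hP hs hl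
    have key : ∀ {x y : List A}, (∀ c ∈ x, c ∈ B \ {b}) → (∀ c ∈ y, c ∈ B) →
        (x ∈ P.language ↔ x ++ b :: y ∈ (P.concat b ⟨B, []⟩).language) := by
      intro x y hx hy
      rw [mem_language_concat]
      refine ⟨fun h => ⟨x, y, rfl, h, mem_language_nil.2 hy⟩, ?_⟩
      rintro ⟨x', y', he, hx', -⟩
      rwa [(append_cons_inj_left (hn hx) (hn (hl x' hx')) he).1]
    rw [key hx₁ hy₁, key hx₂ hy₂]
    refine h _ (hP.concat (isUnambiguous_nil B) fun x hx x' hx' y _ y' _ =>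
      append_cons_inj_left (hn (hl x hx)) (hn (hl x' hx'))) ?_ ?_
    · rw [size_concat]; simpa [size] using hs
    · intro w hw
      obtain ⟨x, y, rfl, hx, hy⟩ := mem_language_concat.1 hw
      intro c hc
      rw [List.mem_append, List.mem_cons] at hc
      rcases hc with hc | rfl | hc
      · exact (hl x hx c hc).1
      · exact hb
      · exact mem_language_nil.1 hy c hc
  · intro P hP hs hl
    have key : ∀ {x y : List A}, (∀ c ∈ x, c ∈ B \ {b}) →
        (y ∈ P.language ↔
          x ++ b :: y ∈ ((MarkedProduct.mk (B \ {b}) []).concat b P).language) := by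
      intro x y hx
      rw [mem_language_concat]
      refine ⟨fun h => ⟨x, y, rfl, mem_language_nil.2 hx, h⟩, ?_⟩
      rintro ⟨x', y', he, hx', hy'⟩
      rwa [(append_cons_inj_left (hn hx) (hn (mem_language_nil.1 hx')) he).2]
    rw [key hx₁, key hx₂]
    refine h _ ((isUnambiguous_nil _).concat hP fun x hx x' hx' y _ y' _ =>
      append_cons_inj_left (hn (mem_language_nil.1 hx)) (hn (mem_language_nil.1 hx'))) ?_ ?_
    · rw [size_concat]; simpa [size] using hs
    · intro w hw
      obtain ⟨x, y, rfl, hx, hy⟩ := mem_language_concat.1 hw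
      intro c hc
      rw [List.mem_append, List.mem_cons] at hc
      rcases hc with hc | rfl | hc
      · exact (mem_language_nil.1 hx c hc).1
      · exact hb
      · exact hl y hy c hc

theorem ULEquivOn.right {κ : ℕ} {B : Set A} {b : A} (hb : b ∈ B) {x₁ x₂ y₁ y₂ : List A}
    (h : ULEquivOn (κ + 1) B (y₁ ++ b :: x₁) (y₂ ++ b :: x₂))
    (hx₁ : ∀ c ∈ x₁, c ∈ B \ {b}) (hx₂ : ∀ c ∈ x₂, c ∈ B \ {b})
    (hy₁ : ∀ c ∈ y₁, c ∈ B) (hy₂ : ∀ c ∈ y₂, c ∈ B) :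
    ULEquivOn κ (B \ {b}) x₁ x₂ ∧ ULEquivOn κ B y₁ y₂ := by
  have hn {x : List A} (hx : ∀ c ∈ x, c ∈ B \ {b}) : b ∉ x := fun h => (hx b h).2 rfl
  constructor
  · intro P hP hs hl
    have key : ∀ {x y : List A}, (∀ c ∈ x, c ∈ B \ {b}) → (∀ c ∈ y, c ∈ B) →
        (x ∈ P.language ↔ y ++ b :: x ∈ ((MarkedProduct.mk B []).concat b P).language) := by
      intro x y hx hy
      rw [mem_language_concat]
      refine ⟨fun h => ⟨y, x, rfl, mem_language_nil.2 hy, h⟩, ?_⟩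
      rintro ⟨y', x', he, -, hx'⟩
      rwa [(append_cons_inj_right (hn hx) (hn (hl x' hx')) he).2]
    rw [key hx₁ hy₁, key hx₂ hy₂]
    refine h _ ((isUnambiguous_nil B).concat hP fun y _ y' _ x hx x' hx' =>
      append_cons_inj_right (hn (hl x hx)) (hn (hl x' hx'))) ?_ ?_
    · rw [size_concat]; simpa [size] using hs
    · intro w hw
      obtain ⟨y, x, rfl, hy, hx⟩ := mem_language_concat.1 hw
      intro c hc
      rw [List.mem_append, List.mem_cons] at hc
      rcases hc with hc | rfl | hc
      · exact mem_language_nil.1 hy c hc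
      · exact hb
      · exact (hl x hx c hc).1
  · intro P hP hs hl
    have key : ∀ {x y : List A}, (∀ c ∈ x, c ∈ B \ {b}) →
        (y ∈ P.language ↔ y ++ b :: x ∈ (P.concat b ⟨B \ {b}, []⟩).language) := by
      intro x y hx
      rw [mem_language_concat]
      refine ⟨fun h => ⟨y, x, rfl, h, mem_language_nil.2 hx⟩, ?_⟩
      rintro ⟨y', x', he, hy', hx'⟩
      rwa [(append_cons_inj_right (hn hx) (hn (mem_language_nil.1 hx')) he).1]
    rw [key hx₁, key hx₂]
    refine h _ (hP.concat (isUnambiguous_nil _) fun y _ y' _ x hx x' hx' =>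
      append_cons_inj_right (hn (mem_language_nil.1 hx)) (hn (mem_language_nil.1 hx'))) ?_ ?_
    · rw [size_concat]; simpa [size] using hs
    · intro w hw
      obtain ⟨y, x, rfl, hy, hx⟩ := mem_language_concat.1 hw
      intro c hc
      rw [List.mem_append, List.mem_cons] at hc
      rcases hc with hc | rfl | hc
      · exact hl y hy c hc
      · exact hb
      · exact (mem_language_nil.1 hx c hc).1

theorem ULEquivOn.exists_split_left {κ : ℕ} {B : Set A} {b : A} (hb : b ∈ B) {x y w : List A}
    (h : ULEquivOn (κ + 1) B (x ++ b :: y) w) (hx : ∀ c ∈ x, c ∈ B \ {b})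
    (hy : ∀ c ∈ y, c ∈ B) :
    ∃ x' y', w = x' ++ b :: y' ∧ (∀ c ∈ x', c ∈ B \ {b}) ∧ ∀ c ∈ y', c ∈ B := by
  have hn {x : List A} (hx : ∀ c ∈ x, c ∈ B \ {b}) : b ∉ x := fun h => (hx b h).2 rfl
  have := (h ((MarkedProduct.mk (B \ {b}) []).concat b ⟨B, []⟩)
    ((isUnambiguous_nil _).concat (isUnambiguous_nil _) fun x hx x' hx' y _ y' _ =>
      append_cons_inj_left (hn (mem_language_nil.1 hx)) (hn (mem_language_nil.1 hx')))
    (by rw [size_concat]; simp [size]) ?_).1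
    (mem_language_concat.2 ⟨x, y, rfl, mem_language_nil.2 hx, mem_language_nil.2 hy⟩)
  · obtain ⟨x', y', rfl, hx', hy'⟩ := mem_language_concat.1 this
    exact ⟨x', y', rfl, mem_language_nil.1 hx', mem_language_nil.1 hy'⟩
  · intro w hw
    obtain ⟨x, y, rfl, hx, hy⟩ := mem_language_concat.1 hw
    intro c hc
    rw [List.mem_append, List.mem_cons] at hc
    rcases hc with hc | rfl | hc
    · exact (mem_language_nil.1 hx c hc).1
    · exact hb
    · exact mem_language_nil.1 hy c hc

theorem ULEquivOn.exists_split_right {κ : ℕ} {B : Set A} {b : A} (hb : b ∈ B) {x y w : List A}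
    (h : ULEquivOn (κ + 1) B (y ++ b :: x) w) (hx : ∀ c ∈ x, c ∈ B \ {b})
    (hy : ∀ c ∈ y, c ∈ B) :
    ∃ x' y', w = y' ++ b :: x' ∧ (∀ c ∈ x', c ∈ B \ {b}) ∧ ∀ c ∈ y', c ∈ B := by
  have hn {x : List A} (hx : ∀ c ∈ x, c ∈ B \ {b}) : b ∉ x := fun h => (hx b h).2 rfl
  have := (h ((MarkedProduct.mk B []).concat b ⟨B \ {b}, []⟩)
    ((isUnambiguous_nil _).concat (isUnambiguous_nil _) fun y _ y' _ x hx x' hx' =>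
      append_cons_inj_right (hn (mem_language_nil.1 hx)) (hn (mem_language_nil.1 hx')))
    (by rw [size_concat]; simp [size]) ?_).1
    (mem_language_concat.2 ⟨y, x, rfl, mem_language_nil.2 hy, mem_language_nil.2 hx⟩)
  · obtain ⟨y', x', rfl, hy', hx'⟩ := mem_language_concat.1 this
    exact ⟨x', y', rfl, mem_language_nil.1 hx', mem_language_nil.1 hy'⟩
  · intro w hw
    obtain ⟨y, x, rfl, hy, hx⟩ := mem_language_concat.1 hw
    intro c hc
    rw [List.mem_append, List.mem_cons] at hc
    rcases hc with hc | rfl | hc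
    · exact mem_language_nil.1 hy c hc
    · exact hb
    · exact (mem_language_nil.1 hx c hc).1

/-! ### Cell families -/

/-- The words over `B` split into finitely many disjoint unambiguous products such that words in
the same product are related by `R`, and words that no unambiguous product of size at most `κ`
distinguishes are in the same product. -/
structure IsCellFamily (κ : ℕ) (B : Set A) (R : List A → List A → Prop)
    (𝓕 : Set (MarkedProduct A)) : Prop where
  finite : 𝓕.Finite
  unambiguous : ∀ P ∈ 𝓕, P.IsUnambiguous
  disjoint : ∀ P ∈ 𝓕, ∀ Q ∈ 𝓕, ∀ w ∈ P.language, w ∈ Q.language → P = Q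
  mem : ∀ P ∈ 𝓕, ∀ w ∈ P.language, ∀ c ∈ w, c ∈ B
  cover : ∀ w : List A, (∀ c ∈ w, c ∈ B) → ∃ P ∈ 𝓕, w ∈ P.language
  rel : ∀ P ∈ 𝓕, ∀ w₁ ∈ P.language, ∀ w₂ ∈ P.language, R w₁ w₂
  mem_of_equiv : ∀ P ∈ 𝓕, ∀ w₁ ∈ P.language, ∀ w₂, (∀ c ∈ w₂, c ∈ B) →
    ULEquivOn κ B w₁ w₂ → w₂ ∈ P.language

theorem IsCellFamily.base {B : Set A} {R : List A → List A → Prop}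
    (h : ∀ w₁ w₂, (∀ c ∈ w₁, c ∈ B) → (∀ c ∈ w₂, c ∈ B) → R w₁ w₂) (κ : ℕ) :
    IsCellFamily κ B R {⟨B, []⟩} where
  finite := Set.finite_singleton _
  unambiguous := by rintro _ rfl; exact isUnambiguous_nil B
  disjoint := by rintro _ rfl _ rfl _ _ _; rfl
  mem := by rintro _ rfl w hw; exact mem_language_nil.1 hw
  cover w hw := ⟨_, rfl, mem_language_nil.2 hw⟩
  rel := by
    rintro _ rfl w₁ hw₁ w₂ hw₂
    exact h _ _ (mem_language_nil.1 hw₁) (mem_language_nil.1 hw₂)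
  mem_of_equiv := by
    rintro _ rfl w₁ _ w₂ hw₂ _
    exact mem_language_nil.2 hw₂

theorem eq_append_cons_of_mem_right {b : A} {w : List A} (h : b ∈ w) :
    ∃ x y, w = x ++ b :: y ∧ b ∉ y := by
  obtain ⟨x, y, h, hx⟩ := List.eq_append_cons_of_mem (List.mem_reverse.2 h)
  refine ⟨y.reverse, x.reverse, ?_, by simpa using hx⟩
  rw [← List.reverse_reverse w, h]
  simp

/-- Words without `b` keep their cell in `𝒞`; the others are cut at their first `b`. Sizes of the
products add up, but by `ULEquivOn.left` the saturation bound grows only by `1`. -/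
theorem IsCellFamily.left {κ : ℕ} {B : Set A} {b : A} (hb : b ∈ B)
    {R₀ R₁ R : List A → List A → Prop} {𝒞 𝒟 : Set (MarkedProduct A)}
    (h𝒞 : IsCellFamily κ (B \ {b}) R₀ 𝒞) (h𝒟 : IsCellFamily κ B R₁ 𝒟)
    (hR₀ : ∀ x₁ x₂, R₀ x₁ x₂ → R x₁ x₂)
    (hR : ∀ x₁ x₂ y₁ y₂, R₀ x₁ x₂ → R₁ y₁ y₂ → R (x₁ ++ b :: y₁) (x₂ ++ b :: y₂)) :
    IsCellFamily (κ + 1) B R (𝒞 ∪ Set.image2 (fun C D => C.concat b D) 𝒞 𝒟) := by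
  have hn {x : List A} (hx : ∀ c ∈ x, c ∈ B \ {b}) : b ∉ x := fun h => (hx b h).2 rfl
  have hnC {C : MarkedProduct A} (hC : C ∈ 𝒞) {x} (hx : x ∈ C.language) : b ∉ x :=
    hn (h𝒞.mem C hC x hx)
  refine ⟨h𝒞.finite.union (h𝒞.finite.image2 _ h𝒟.finite), ?_, ?_, ?_, ?_, ?_, ?_⟩
  · rintro _ (hC | ⟨C, hC, D, hD, rfl⟩)
    · exact h𝒞.unambiguous _ hC
    · exact (h𝒞.unambiguous C hC).concat (h𝒟.unambiguous D hD) fun x hx x' hx' y _ y' _ =>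
        append_cons_inj_left (hnC hC hx) (hnC hC hx')
  · rintro P (hC | ⟨C, hC, D, hD, rfl⟩) Q (hC' | ⟨C', hC', D', hD', rfl⟩) w hw hw'
    · exact h𝒞.disjoint _ hC _ hC' w hw hw'
    · obtain ⟨x, y, rfl, -, -⟩ := mem_language_concat.1 hw'
      exact absurd (by simp) (hnC hC hw)
    · obtain ⟨x, y, rfl, -, -⟩ := mem_language_concat.1 hw
      exact absurd (by simp) (hnC hC' hw')
    · obtain ⟨x, y, rfl, hx, hy⟩ := mem_language_concat.1 hw
      obtain ⟨x', y', he, hx', hy'⟩ := mem_language_concat.1 hw'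
      obtain ⟨rfl, rfl⟩ := append_cons_inj_left (hnC hC hx) (hnC hC' hx') he
      rw [h𝒞.disjoint _ hC _ hC' x hx hx', h𝒟.disjoint _ hD _ hD' y hy hy']
  · rintro P (hC | ⟨C, hC, D, hD, rfl⟩) w hw c hc
    · exact (h𝒞.mem _ hC _ hw c hc).1
    · obtain ⟨x, y, rfl, hx, hy⟩ := mem_language_concat.1 hw
      rw [List.mem_append, List.mem_cons] at hc
      rcases hc with hc | rfl | hc
      · exact (h𝒞.mem _ hC _ hx c hc).1
      · exact hb
      · exact h𝒟.mem _ hD _ hy c hc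
  · intro w hw
    by_cases hbw : b ∈ w
    · obtain ⟨x, y, rfl, hx⟩ := List.eq_append_cons_of_mem hbw
      obtain ⟨C, hC, hxC⟩ := h𝒞.cover x fun c hc =>
        ⟨hw c (by simp [hc]), by rintro rfl; exact hx hc⟩
      obtain ⟨D, hD, hyD⟩ := h𝒟.cover y fun c hc => hw c (by simp [hc])
      exact ⟨_, Or.inr ⟨C, hC, D, hD, rfl⟩, mem_language_concat.2 ⟨x, y, rfl, hxC, hyD⟩⟩
    · obtain ⟨C, hC, hwC⟩ := h𝒞.cover w fun c hc => ⟨hw c hc, by rintro rfl; exact hbw hc⟩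
      exact ⟨C, Or.inl hC, hwC⟩
  · rintro P (hC | ⟨C, hC, D, hD, rfl⟩) w₁ hw₁ w₂ hw₂
    · exact hR₀ _ _ (h𝒞.rel _ hC _ hw₁ _ hw₂)
    · obtain ⟨x₁, y₁, rfl, hx₁, hy₁⟩ := mem_language_concat.1 hw₁
      obtain ⟨x₂, y₂, rfl, hx₂, hy₂⟩ := mem_language_concat.1 hw₂
      exact hR _ _ _ _ (h𝒞.rel _ hC _ hx₁ _ hx₂) (h𝒟.rel _ hD _ hy₁ _ hy₂)
  · rintro P (hC | ⟨C, hC, D, hD, rfl⟩) w₁ hw₁ w₂ hw₂ he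
    · refine h𝒞.mem_of_equiv P hC w₁ hw₁ w₂ ?_ (he.mono (by omega) Set.sdiff_subset)
      -- The product `(B \ {b})*` of size `0` detects the absence of `b`.
      have := (he ⟨B \ {b}, []⟩ (isUnambiguous_nil _) (by simp [size])
        fun w hw c hc => (mem_language_nil.1 hw c hc).1).1
        (mem_language_nil.2 (h𝒞.mem P hC w₁ hw₁))
      exact mem_language_nil.1 this
    · obtain ⟨x₁, y₁, rfl, hx₁, hy₁⟩ := mem_language_concat.1 hw₁
      have hx₁' := h𝒞.mem C hC x₁ hx₁
      have hy₁' := h𝒟.mem D hD y₁ hy₁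
      obtain ⟨x₂, y₂, rfl, hx₂, hy₂⟩ := he.exists_split_left hb hx₁' hy₁'
      obtain ⟨hx, hy⟩ := he.left hb hx₁' hx₂ hy₁' hy₂
      exact mem_language_concat.2 ⟨x₂, y₂, rfl, h𝒞.mem_of_equiv C hC _ hx₁ _ hx₂ hx,
        h𝒟.mem_of_equiv D hD _ hy₁ _ hy₂ hy⟩

theorem IsCellFamily.right {κ : ℕ} {B : Set A} {b : A} (hb : b ∈ B)
    {R₀ R₁ R : List A → List A → Prop} {𝒞 𝒟 : Set (MarkedProduct A)}
    (h𝒞 : IsCellFamily κ (B \ {b}) R₀ 𝒞) (h𝒟 : IsCellFamily κ B R₁ 𝒟)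
    (hR₀ : ∀ x₁ x₂, R₀ x₁ x₂ → R x₁ x₂)
    (hR : ∀ x₁ x₂ y₁ y₂, R₀ x₁ x₂ → R₁ y₁ y₂ → R (y₁ ++ b :: x₁) (y₂ ++ b :: x₂)) :
    IsCellFamily (κ + 1) B R (𝒞 ∪ Set.image2 (fun C D => D.concat b C) 𝒞 𝒟) := by
  have hn {x : List A} (hx : ∀ c ∈ x, c ∈ B \ {b}) : b ∉ x := fun h => (hx b h).2 rfl
  have hnC {C : MarkedProduct A} (hC : C ∈ 𝒞) {x} (hx : x ∈ C.language) : b ∉ x :=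
    hn (h𝒞.mem C hC x hx)
  refine ⟨h𝒞.finite.union (h𝒞.finite.image2 _ h𝒟.finite), ?_, ?_, ?_, ?_, ?_, ?_⟩
  · rintro _ (hC | ⟨C, hC, D, hD, rfl⟩)
    · exact h𝒞.unambiguous _ hC
    · exact (h𝒟.unambiguous D hD).concat (h𝒞.unambiguous C hC) fun y _ y' _ x hx x' hx' =>
        append_cons_inj_right (hnC hC hx) (hnC hC hx')
  · rintro P (hC | ⟨C, hC, D, hD, rfl⟩) Q (hC' | ⟨C', hC', D', hD', rfl⟩) w hw hw'
    · exact h𝒞.disjoint _ hC _ hC' w hw hw'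
    · obtain ⟨x, y, rfl, -, -⟩ := mem_language_concat.1 hw'
      exact absurd (by simp) (hnC hC hw)
    · obtain ⟨x, y, rfl, -, -⟩ := mem_language_concat.1 hw
      exact absurd (by simp) (hnC hC' hw')
    · obtain ⟨y, x, rfl, hy, hx⟩ := mem_language_concat.1 hw
      obtain ⟨y', x', he, hy', hx'⟩ := mem_language_concat.1 hw'
      obtain ⟨rfl, rfl⟩ := append_cons_inj_right (hnC hC hx) (hnC hC' hx') he
      rw [h𝒞.disjoint _ hC _ hC' x hx hx', h𝒟.disjoint _ hD _ hD' y hy hy']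
  · rintro P (hC | ⟨C, hC, D, hD, rfl⟩) w hw c hc
    · exact (h𝒞.mem _ hC _ hw c hc).1
    · obtain ⟨y, x, rfl, hy, hx⟩ := mem_language_concat.1 hw
      rw [List.mem_append, List.mem_cons] at hc
      rcases hc with hc | rfl | hc
      · exact h𝒟.mem _ hD _ hy c hc
      · exact hb
      · exact (h𝒞.mem _ hC _ hx c hc).1
  · intro w hw
    by_cases hbw : b ∈ w
    · obtain ⟨y, x, rfl, hx⟩ := eq_append_cons_of_mem_right hbw
      obtain ⟨C, hC, hxC⟩ := h𝒞.cover x fun c hc =>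
        ⟨hw c (by simp [hc]), by rintro rfl; exact hx hc⟩
      obtain ⟨D, hD, hyD⟩ := h𝒟.cover y fun c hc => hw c (by simp [hc])
      exact ⟨_, Or.inr ⟨C, hC, D, hD, rfl⟩, mem_language_concat.2 ⟨y, x, rfl, hyD, hxC⟩⟩
    · obtain ⟨C, hC, hwC⟩ := h𝒞.cover w fun c hc => ⟨hw c hc, by rintro rfl; exact hbw hc⟩
      exact ⟨C, Or.inl hC, hwC⟩
  · rintro P (hC | ⟨C, hC, D, hD, rfl⟩) w₁ hw₁ w₂ hw₂
    · exact hR₀ _ _ (h𝒞.rel _ hC _ hw₁ _ hw₂)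
    · obtain ⟨y₁, x₁, rfl, hy₁, hx₁⟩ := mem_language_concat.1 hw₁
      obtain ⟨y₂, x₂, rfl, hy₂, hx₂⟩ := mem_language_concat.1 hw₂
      exact hR _ _ _ _ (h𝒞.rel _ hC _ hx₁ _ hx₂) (h𝒟.rel _ hD _ hy₁ _ hy₂)
  · rintro P (hC | ⟨C, hC, D, hD, rfl⟩) w₁ hw₁ w₂ hw₂ he
    · refine h𝒞.mem_of_equiv P hC w₁ hw₁ w₂ ?_ (he.mono (by omega) Set.sdiff_subset)
      have := (he ⟨B \ {b}, []⟩ (isUnambiguous_nil _) (by simp [size])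
        fun w hw c hc => (mem_language_nil.1 hw c hc).1).1
        (mem_language_nil.2 (h𝒞.mem P hC w₁ hw₁))
      exact mem_language_nil.1 this
    · obtain ⟨y₁, x₁, rfl, hy₁, hx₁⟩ := mem_language_concat.1 hw₁
      have hx₁' := h𝒞.mem C hC x₁ hx₁
      have hy₁' := h𝒟.mem D hD y₁ hy₁
      obtain ⟨x₂, y₂, rfl, hx₂, hy₂⟩ := he.exists_split_right hb hx₁' hy₁'
      obtain ⟨hx, hy⟩ := he.right hb hx₁' hx₂ hy₁' hy₂
      exact mem_language_concat.2 ⟨y₂, x₂, rfl, h𝒟.mem_of_equiv D hD _ hy₁ _ hy₂ hy,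
        h𝒞.mem_of_equiv C hC _ hx₁ _ hx₂ hx⟩

theorem IsCellFamily.mono {κ κ' : ℕ} {B : Set A} {R R' : List A → List A → Prop}
    {𝓕 : Set (MarkedProduct A)} (h : IsCellFamily κ B R 𝓕) (hκ : κ ≤ κ')
    (hR : ∀ w₁ w₂, R w₁ w₂ → R' w₁ w₂) : IsCellFamily κ' B R' 𝓕 :=
  { h with
    rel := fun P hP w₁ hw₁ w₂ hw₂ => hR _ _ (h.rel P hP w₁ hw₁ w₂ hw₂)
    mem_of_equiv := fun P hP w₁ hw₁ w₂ hw₂ he =>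
      h.mem_of_equiv P hP w₁ hw₁ w₂ hw₂ (he.mono hκ subset_rfl) }

end

/-! ### Values of equivalent pairs in a finite monoid -/

section

open MarkedProduct

open scoped Pointwise

variable {A : Type*}

theorem exists_lt_le_map_eq {G : Type*} [Finite G] {n : ℕ} (hn : Nat.card G ≤ n)
    (f : ℕ → G) : ∃ i j, i < j ∧ j ≤ n ∧ f i = f j := by
  have := Fintype.ofFinite G
  obtain ⟨i, j, hij, he⟩ := Fintype.exists_ne_map_eq_of_card_lt
    (fun i : Fin (n + 1) => f i)
    (by rw [Fintype.card_fin, ← Nat.card_eq_fintype_card]; omega)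
  rcases lt_or_gt_of_ne hij with h | h
  · exact ⟨i, j, h, by omega, he⟩
  · exact ⟨j, i, h, by omega, he.symm⟩

theorem List.exists_append_eq_of_lt {G : Type*} (l : List G) {i j : ℕ} (hij : i < j)
    (hj : j ≤ l.length) : ∃ l₁ l₂ l₃, l = l₁ ++ l₂ ++ l₃ ∧ l₂ ≠ [] ∧ l.take i = l₁ ∧
      l.take j = l₁ ++ l₂ ∧ l.drop i = l₂ ++ l₃ ∧ l.drop j = l₃ := by
  have h1 : l.take j = l.take i ++ (l.take j).drop i := by
    conv_lhs => rw [← List.take_append_drop i (l.take j), List.take_take, min_eq_left hij.le]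
  have h2 : l.drop i = (l.take j).drop i ++ l.drop j := by
    conv_lhs => rw [← List.take_append_drop j l]
    rw [List.drop_append_of_le_length (by simp; omega)]
  refine ⟨l.take i, (l.take j).drop i, l.drop j, ?_, ?_, rfl, h1, h2, rfl⟩
  · rw [← h1, List.take_append_drop]
  · rw [ne_eq, List.drop_eq_nil_iff]
    simp; omega

/-- Pigeonhole on the prefix products, of which there are `l.length + 1`, counting the empty one. -/
theorem List.exists_prod_mul_prod_eq_left {G : Type*} [Monoid G] [Finite G] (l : List G)
    (hl : Nat.card G ≤ l.length) :
    ∃ l₁ l₂ l₃, l = l₁ ++ l₂ ++ l₃ ∧ l₂ ≠ [] ∧ l₁.prod * l₂.prod = l₁.prod := by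
  obtain ⟨i, j, hij, hj, he⟩ := exists_lt_le_map_eq hl fun i => (l.take i).prod
  obtain ⟨l₁, l₂, l₃, h, hne, h₁, h₂, -, -⟩ := l.exists_append_eq_of_lt hij hj
  refine ⟨l₁, l₂, l₃, h, hne, ?_⟩
  rw [← List.prod_append, ← h₂, ← h₁]
  exact he.symm

theorem List.exists_prod_mul_prod_eq_right {G : Type*} [Monoid G] [Finite G] (l : List G)
    (hl : Nat.card G ≤ l.length) :
    ∃ l₁ l₂ l₃, l = l₁ ++ l₂ ++ l₃ ∧ l₂ ≠ [] ∧ l₂.prod * l₃.prod = l₃.prod := by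
  obtain ⟨i, j, hij, hj, he⟩ := exists_lt_le_map_eq hl fun i => (l.drop i).prod
  obtain ⟨l₁, l₂, l₃, h, hne, -, -, h₁, h₂⟩ := l.exists_append_eq_of_lt hij hj
  refine ⟨l₁, l₂, l₃, h, hne, ?_⟩
  rw [← List.prod_append, ← h₁, ← h₂]
  exact he

/-- The values of pairs of `≡_k`-equivalent words over `B` that contain all letters of `C`. -/
def matchedValues {G : Type*} (g : List A → List A → G) (k : ℕ) (C B : Set A) : Set G :=
  {m | ∃ u v, (∀ c ∈ u, c ∈ B) ∧ (∀ c ∈ v, c ∈ B) ∧ (∀ c ∈ C, c ∈ u ∧ c ∈ v) ∧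
    ulSetoid A k u v ∧ g u v = m}

section

variable {G : Type*} {g : List A → List A → G}

theorem matchedValues_mono {k : ℕ} {C C' B B' : Set A} (hC : C' ⊆ C) (hB : B ⊆ B') :
    matchedValues g k C B ⊆ matchedValues g k C' B' := by
  rintro m ⟨u, v, hu, hv, hc, he, rfl⟩
  exact ⟨u, v, fun c h => hB (hu c h), fun c h => hB (hv c h), fun c h => hc c (hC h), he, rfl⟩

theorem apply_self_mem_matchedValues {k : ℕ} {C B : Set A} {w : List A}
    (hB : ∀ c ∈ w, c ∈ B) (hC : ∀ c ∈ C, c ∈ w) : g w w ∈ matchedValues g k C B :=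
  ⟨w, w, hB, hB, fun c hc => ⟨hC c hc, hC c hc⟩, (ulSetoid A k).refl _, rfl⟩

variable [Monoid G]

/-- `g` is a morphism from pairs of words. -/
structure IsPairHom (g : List A → List A → G) : Prop where
  nil : g [] [] = 1
  append : ∀ u u' v v', g (u ++ u') (v ++ v') = g u v * g u' v'

theorem IsPairHom.map_wpow (hg : IsPairHom g) (u v : List A) (N : ℕ) :
    g (wpow u N) (wpow v N) = g u v ^ N := by
  induction N with
  | zero => simpa [wpow] using hg.nil
  | succ N ih => rw [wpow_add, wpow_add, wpow_one, wpow_one, hg.append, ih, pow_succ]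

theorem IsPairHom.mul_mem_matchedValues (hg : IsPairHom g) {k : ℕ} {C D B : Set A} {m m' : G}
    (hm : m ∈ matchedValues g k C B) (hm' : m' ∈ matchedValues g k D B) :
    m * m' ∈ matchedValues g k (C ∪ D) B := by
  obtain ⟨u, v, hu, hv, hc, he, rfl⟩ := hm
  obtain ⟨u', v', hu', hv', hc', he', rfl⟩ := hm'
  refine ⟨u ++ u', v ++ v', ?_, ?_, ?_, ulSetoid_append he he', hg.append _ _ _ _⟩
  · exact fun c h => (List.mem_append.1 h).elim (hu c) (hu' c)
  · exact fun c h => (List.mem_append.1 h).elim (hv c) (hv' c)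
  · rintro c (h | h)
    · exact ⟨List.mem_append_left _ (hc c h).1, List.mem_append_left _ (hc c h).2⟩
    · exact ⟨List.mem_append_right _ (hc' c h).1, List.mem_append_right _ (hc' c h).2⟩

theorem IsPairHom.mul_mem_matchedValues_empty (hg : IsPairHom g) {k : ℕ} {B : Set A} {m m' : G}
    (hm : m ∈ matchedValues g k ∅ B) (hm' : m' ∈ matchedValues g k ∅ B) :
    m * m' ∈ matchedValues g k ∅ B := by
  simpa using hg.mul_mem_matchedValues hm hm'

theorem IsPairHom.list_prod_mem_matchedValues (hg : IsPairHom g) {k : ℕ} {B : Set A}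
    {l : List G} (hl : ∀ m ∈ l, m ∈ matchedValues g k B B) :
    l.prod ∈ matchedValues g k ∅ B ∧ (l ≠ [] → l.prod ∈ matchedValues g k B B) := by
  induction l with
  | nil =>
    rw [List.prod_nil, ← hg.nil]
    exact ⟨apply_self_mem_matchedValues (by simp) (by simp), by simp⟩
  | cons m l ih =>
    have h := hg.mul_mem_matchedValues (hl m (by simp)) (ih fun m' h => hl m' (by simp [h])).1
    rw [Set.union_empty, ← List.prod_cons] at h
    exact ⟨matchedValues_mono (Set.empty_subset _) subset_rfl h, fun _ => h⟩

/-- Long products of values of matched pairs with all letters of `B` stay matched around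
arbitrary words over `B`. -/
theorem IsPairHom.prod_mul_mul_prod_mem_matchedValues [Finite G] (hg : IsPairHom g) {k : ℕ}
    {B : Set A} {l l' : List G} (hl : ∀ m ∈ l, m ∈ matchedValues g k B B)
    (hl' : ∀ m ∈ l', m ∈ matchedValues g k B B) (hc : Nat.card G ≤ l.length)
    (hc' : Nat.card G ≤ l'.length) {y₁ y₂ : List A} (hy₁ : ∀ c ∈ y₁, c ∈ B)
    (hy₂ : ∀ c ∈ y₂, c ∈ B) : l.prod * g y₁ y₂ * l'.prod ∈ matchedValues g k ∅ B := by
  obtain ⟨s, t, r, rfl, ht, hst⟩ := l.exists_prod_mul_prod_eq_left hc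
  obtain ⟨r', t', s', rfl, ht', hst'⟩ := l'.exists_prod_mul_prod_eq_right hc'
  simp only [List.mem_append, or_imp, forall_and] at hl hl'
  have hs := (hg.list_prod_mem_matchedValues hl.1.1).1
  have hs' := (hg.list_prod_mem_matchedValues hl'.2).1
  obtain ⟨t₁, t₂, htB₁, htB₂, htC, hte, ht⟩ := (hg.list_prod_mem_matchedValues hl.1.2).2 ht
  obtain ⟨t₁', t₂', htB₁', htB₂', htC', hte', ht'⟩ :=
    (hg.list_prod_mem_matchedValues hl'.1.2).2 ht'
  obtain ⟨r₁, r₂, hrB₁, hrB₂, -, -, hr⟩ := (hg.list_prod_mem_matchedValues hl.2).1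
  obtain ⟨r₁', r₂', hrB₁', hrB₂', -, -, hr'⟩ := (hg.list_prod_mem_matchedValues hl'.1.1).1
  have hpow : ∀ N, s.prod * t.prod ^ N = s.prod := by
    intro N
    induction N with
    | zero => simp
    | succ N ih => rw [pow_succ, ← mul_assoc, ih, hst]
  have hpow' : ∀ N, t'.prod ^ N * s'.prod = s'.prod := by
    intro N
    induction N with
    | zero => simp
    | succ N ih => rw [pow_succ, mul_assoc, hst', ih]
  -- The exponent `k + 1` exceeds the size of every product tested by `≡_k`, so `y₁` and `y₂` become
  -- invisible; `hpow` and `hpow'` show that `s` and `s'` absorb the powers.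
  have hmid : t.prod ^ (k + 1) * (r.prod * g y₁ y₂ * r'.prod) * t'.prod ^ (k + 1) ∈
      matchedValues g k ∅ B := by
    refine ⟨wpow t₁ (k + 1) ++ (r₁ ++ y₁ ++ r₁') ++ wpow t₁' (k + 1),
      wpow t₂ (k + 1) ++ (r₂ ++ y₂ ++ r₂') ++ wpow t₂' (k + 1), ?_, ?_, by simp, ?_, ?_⟩
    · intro c hc
      simp only [List.mem_append] at hc
      rcases hc with (hc | (hc | hc) | hc) | hc
      exacts [htB₁ c (mem_of_mem_wpow hc), hrB₁ c hc, hy₁ c hc, hrB₁' c hc,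
        htB₁' c (mem_of_mem_wpow hc)]
    · intro c hc
      simp only [List.mem_append] at hc
      rcases hc with (hc | (hc | hc) | hc) | hc
      exacts [htB₂ c (mem_of_mem_wpow hc), hrB₂ c hc, hy₂ c hc, hrB₂' c hc,
        htB₂' c (mem_of_mem_wpow hc)]
    · refine ulSetoid_wpow_append_wpow (Nat.lt_succ_self k) hte hte'
        (fun c => ⟨fun h => (htC' c (htB₁ c h)).1, fun h => (htC c (htB₁' c h)).1⟩) ?_ ?_
      · intro c hc
        simp only [List.mem_append] at hc
        rcases hc with (hc | hc) | hc
        exacts [(htC c (hrB₁ c hc)).1, (htC c (hy₁ c hc)).1, (htC c (hrB₁' c hc)).1]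
      · intro c hc
        simp only [List.mem_append] at hc
        rcases hc with (hc | hc) | hc
        exacts [(htC c (hrB₂ c hc)).1, (htC c (hy₂ c hc)).1, (htC c (hrB₂' c hc)).1]
    · simp only [hg.append, hg.map_wpow, ht, ht', hr, hr']
  have := hg.mul_mem_matchedValues_empty (hg.mul_mem_matchedValues_empty hs hmid) hs'
  convert this using 1
  have e : s.prod * (t.prod ^ (k + 1) * (r.prod * g y₁ y₂ * r'.prod) * t'.prod ^ (k + 1)) *
      s'.prod = s.prod * t.prod ^ (k + 1) * (r.prod * g y₁ y₂ * r'.prod) *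
        (t'.prod ^ (k + 1) * s'.prod) := by simp only [mul_assoc]
  have e' : (s ++ t ++ r).prod * g y₁ y₂ * (r' ++ t' ++ s').prod =
      s.prod * t.prod * (r.prod * g y₁ y₂ * r'.prod) * (t'.prod * s'.prod) := by
    simp only [List.prod_append, mul_assoc]
  rw [e, e', hpow, hpow', hst, hst']

/-- The values of `x₁ b, x₂ b` where the values of `x₁, x₂` are matched over `B \ {b}`. -/
def leftStep (g : List A → List A → G) (B : Set A) (b : A) : Set G :=
  {m | ∃ m', (∀ k, m' ∈ matchedValues g k ∅ (B \ {b})) ∧ m = m' * g [b] [b]}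

/-- The values of `b x₁, b x₂` where the values of `x₁, x₂` are matched over `B \ {b}`. -/
def rightStep (g : List A → List A → G) (B : Set A) (b : A) : Set G :=
  {m | ∃ m', (∀ k, m' ∈ matchedValues g k ∅ (B \ {b})) ∧ m = g [b] [b] * m'}

theorem IsPairHom.leftStep_subset (hg : IsPairHom g) {B : Set A} {b : A} (hb : b ∈ B) (k : ℕ) :
    leftStep g B b ⊆ matchedValues g k {b} B := by
  rintro _ ⟨m, hm, rfl⟩
  have := hg.mul_mem_matchedValues (matchedValues_mono subset_rfl Set.sdiff_subset (hm k))
    (apply_self_mem_matchedValues (w := [b]) (C := {b}) (by simpa using hb) (by simp))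
  simpa using this

theorem IsPairHom.rightStep_subset (hg : IsPairHom g) {B : Set A} {b : A} (hb : b ∈ B) (k : ℕ) :
    rightStep g B b ⊆ matchedValues g k {b} B := by
  rintro _ ⟨m, hm, rfl⟩
  have := hg.mul_mem_matchedValues
    (apply_self_mem_matchedValues (w := [b]) (C := {b}) (by simpa using hb) (by simp))
    (matchedValues_mono subset_rfl Set.sdiff_subset (hm k))
  simpa using this

theorem IsPairHom.list_map_prod_subset (hg : IsPairHom g) {B : Set A} {k : ℕ} {S : A → Set G}
    {L : List A} (hS : ∀ b ∈ L, S b ⊆ matchedValues g k {b} B) :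
    (L.map S).prod ⊆ matchedValues g k {b | b ∈ L} B := by
  induction L with
  | nil =>
    rintro m hm
    obtain rfl : m = 1 := by simpa using hm
    exact hg.nil ▸ apply_self_mem_matchedValues (by simp) (by simp)
  | cons b L ih =>
    rw [List.map_cons, List.prod_cons]
    rintro _ ⟨m, hm, m', hm', rfl⟩
    have := hg.mul_mem_matchedValues (hS b (by simp) hm)
      (ih (fun b hb => hS b (by simp [hb])) hm')
    refine matchedValues_mono ?_ subset_rfl this
    intro c hc
    simpa using hc

/-! ### Peeling off letters from both ends -/

/-- The pairs of words that are matched for all `k` between any value in `Z` and any in `W`. -/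
def MatchedBetween (g : List A → List A → G) (B : Set A) (Z W : Set G) (y₁ y₂ : List A) : Prop :=
  ∀ z ∈ Z, ∀ w ∈ W, ∀ k, z * g y₁ y₂ * w ∈ matchedValues g k ∅ B

/-- Each letter of `L` costs one cut, and the value of the piece cut off joins the left context `Z`.
A remainder without the letter is already matched over the smaller alphabet, and the contexts are
matched too. -/
theorem IsPairHom.exists_isCellFamily_left (hg : IsPairHom g) {κ : ℕ} {B : Set A} {W : Set G}
    (hW : ∀ k, W ⊆ matchedValues g k ∅ B) (L : List A) :
    ∀ {κ' : ℕ} {Z : Set G}, κ ≤ κ' → (∀ k, Z ⊆ matchedValues g k ∅ B) →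
    (∀ b ∈ L, b ∈ B ∧ ∃ 𝓕, IsCellFamily κ (B \ {b})
      (fun u v => ∀ k, g u v ∈ matchedValues g k ∅ (B \ {b})) 𝓕) →
    (∃ 𝓕, IsCellFamily κ' B (MatchedBetween g B (Z * (L.map (leftStep g B)).prod) W) 𝓕) →
    ∃ 𝓕, IsCellFamily (κ' + L.length) B (MatchedBetween g B Z W) 𝓕 := by
  induction L with
  | nil => intro κ' Z _ _ _ h; simpa using h
  | cons b L ih =>
    intro κ' Z hκ hZ hL h
    rw [List.map_cons, List.prod_cons, ← mul_assoc] at h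
    obtain ⟨hb, 𝒞, h𝒞⟩ := hL b (by simp)
    have hZ' : ∀ k, Z * leftStep g B b ⊆ matchedValues g k ∅ B := by
      rintro k _ ⟨z, hz, m, hm, rfl⟩
      exact hg.mul_mem_matchedValues_empty (hZ k hz)
        (matchedValues_mono (Set.empty_subset _) subset_rfl (hg.leftStep_subset hb k hm))
    obtain ⟨𝒟, h𝒟⟩ := ih hκ hZ' (fun b hb => hL b (by simp [hb])) h
    refine ⟨_, (h𝒞.mono (κ' := κ' + L.length) (by omega) fun _ _ h => h).left hb h𝒟 ?_ ?_⟩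
    · intro x₁ x₂ hx z hz w hw k
      exact hg.mul_mem_matchedValues_empty (hg.mul_mem_matchedValues_empty (hZ k hz)
        (matchedValues_mono subset_rfl Set.sdiff_subset (hx k))) (hW k hw)
    · intro x₁ x₂ y₁ y₂ hx hy z hz w hw k
      have := hy (z * (g x₁ x₂ * g [b] [b])) (Set.mul_mem_mul hz ⟨_, hx, rfl⟩) w hw k
      rw [← List.singleton_append, ← List.singleton_append (l := y₂), hg.append, hg.append]
      simpa only [mul_assoc] using this

/-- Mirror image, except that the head of `L` is the cut nearest the middle, so its family is built
before the recursive call. -/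
theorem IsPairHom.exists_isCellFamily_right (hg : IsPairHom g) {κ : ℕ} {B : Set A} {Z : Set G}
    (hZ : ∀ k, Z ⊆ matchedValues g k ∅ B) (L : List A) :
    ∀ {κ' : ℕ} {W : Set G}, κ ≤ κ' → (∀ k, W ⊆ matchedValues g k ∅ B) →
    (∀ b ∈ L, b ∈ B ∧ ∃ 𝓕, IsCellFamily κ (B \ {b})
      (fun u v => ∀ k, g u v ∈ matchedValues g k ∅ (B \ {b})) 𝓕) →
    (∃ 𝓕, IsCellFamily κ' B (MatchedBetween g B Z ((L.map (rightStep g B)).prod * W)) 𝓕) →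
    ∃ 𝓕, IsCellFamily (κ' + L.length) B (MatchedBetween g B Z W) 𝓕 := by
  induction L with
  | nil => intro κ' Z _ _ _ h; simpa using h
  | cons b L ih =>
    intro κ' W hκ hW hL h
    rw [List.map_cons, List.prod_cons, mul_assoc] at h
    obtain ⟨hb, 𝒞, h𝒞⟩ := hL b (by simp)
    obtain ⟨𝒟, h𝒟⟩ := h
    have hW' : ∀ k, (L.map (rightStep g B)).prod * W ⊆ matchedValues g k ∅ B := by
      rintro k _ ⟨m, hm, w, hw, rfl⟩
      refine hg.mul_mem_matchedValues_empty (matchedValues_mono (Set.empty_subset _) subset_rfl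
        (hg.list_map_prod_subset (fun b hb => ?_) hm)) (hW k hw)
      exact hg.rightStep_subset (hL b (by simp [hb])).1 k
    rw [List.length_cons, add_comm L.length, ← add_assoc]
    refine ih (by omega) hW (fun b hb => hL b (by simp [hb]))
      ⟨_, (h𝒞.mono hκ fun _ _ h => h).right hb h𝒟 ?_ ?_⟩
    · intro x₁ x₂ hx z hz w hw k
      exact hg.mul_mem_matchedValues_empty (hg.mul_mem_matchedValues_empty (hZ k hz)
        (matchedValues_mono subset_rfl Set.sdiff_subset (hx k))) (hW' k hw)
    · intro x₁ x₂ y₁ y₂ hx hy z hz w hw k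
      have := hy z hz (g [b] [b] * g x₁ x₂ * w) (Set.mul_mem_mul ⟨_, hx, rfl⟩ hw) k
      rw [← List.singleton_append, ← List.singleton_append (l := x₂), hg.append, hg.append]
      simpa only [mul_assoc] using this

theorem IsPairHom.exists_isCellFamily [Finite G] (hg : IsPairHom g) (n : ℕ) :
    ∀ B : Finset A, B.card = n → ∃ 𝓕, IsCellFamily (Nat.card G * n * (n + 1)) (B : Set A)
      (fun u v => ∀ k, g u v ∈ matchedValues g k ∅ (B : Set A)) 𝓕 := by
  classical
  induction n with
  | zero =>
    intro B hB
    obtain rfl := Finset.card_eq_zero.1 hB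
    refine ⟨_, IsCellFamily.base ?_ _⟩
    intro w₁ w₂ h₁ h₂ k
    have e : ∀ w : List A, (∀ c ∈ w, c ∈ ((∅ : Finset A) : Set A)) → w = [] := fun w h =>
      List.eq_nil_iff_forall_not_mem.2 fun c hc => by simpa using h c hc
    rw [e w₁ h₁, e w₂ h₂]
    exact apply_self_mem_matchedValues (by simp) (by simp)
  | succ n ih =>
    intro B hB
    -- One round through `B` yields a matched pair containing all letters of `B`; `|G|` rounds are
    -- what the pigeonhole argument needs.
    set L := (List.replicate (Nat.card G) B.toList).flatten with hLdef
    have hlen : L.length = Nat.card G * (n + 1) := by simp [hLdef, hB]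
    have hmem : ∀ b ∈ L, b ∈ B := by
      intro b hb
      simp only [hLdef, List.mem_flatten, List.mem_replicate] at hb
      obtain ⟨_, ⟨-, rfl⟩, hb⟩ := hb
      simpa using hb
    have hL : ∀ b ∈ L, b ∈ (B : Set A) ∧ ∃ 𝓕, IsCellFamily (Nat.card G * n * (n + 1))
        ((B : Set A) \ {b}) (fun u v => ∀ k, g u v ∈ matchedValues g k ∅ ((B : Set A) \ {b})) 𝓕 := by
      intro b hb
      have := ih (B.erase b) (by rw [Finset.card_erase_of_mem (hmem b hb), hB]; rfl)
      rw [Finset.coe_erase] at this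
      exact ⟨hmem b hb, this⟩
    have hone : ∀ k, (1 : Set G) ⊆ matchedValues g k ∅ (B : Set A) := by
      rintro k m rfl
      rw [← hg.nil]
      exact apply_self_mem_matchedValues (by simp) (by simp)
    have hpow : ∀ S : A → Set G, (∀ b ∈ B, ∀ k, S b ⊆ matchedValues g k {b} (B : Set A)) →
        ∀ z ∈ (L.map S).prod, ∃ l : List G, l.prod = z ∧ Nat.card G ≤ l.length ∧
          ∀ k, ∀ m ∈ l, m ∈ matchedValues g k (B : Set A) (B : Set A) := by
      intro S hS z hz
      rw [hLdef, List.map_flatten, List.prod_flatten, List.map_replicate, List.map_replicate,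
        List.prod_replicate, Set.mem_pow] at hz
      obtain ⟨f, rfl⟩ := hz
      refine ⟨_, rfl, by simp, ?_⟩
      intro k m hm
      obtain ⟨i, rfl⟩ := List.mem_ofFn.1 hm
      have := hg.list_map_prod_subset (L := B.toList) (S := S) (B := (B : Set A)) (k := k)
        (fun b hb => hS b (by simpa using hb) k) (f i).2
      simpa using this
    have hsub : ∀ S : A → Set G, (∀ b ∈ B, ∀ k, S b ⊆ matchedValues g k {b} (B : Set A)) →
        ∀ k, (L.map S).prod ⊆ matchedValues g k ∅ (B : Set A) := fun S hS k =>
      (hg.list_map_prod_subset fun b hb => hS b (hmem b hb) k).trans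
        (matchedValues_mono (Set.empty_subset _) subset_rfl)
    have hleft : ∀ b ∈ B, ∀ k, leftStep g (B : Set A) b ⊆ matchedValues g k {b} (B : Set A) :=
      fun b hb => hg.leftStep_subset hb
    have hright : ∀ b ∈ B, ∀ k, rightStep g (B : Set A) b ⊆ matchedValues g k {b} (B : Set A) :=
      fun b hb => hg.rightStep_subset hb
    have hbase : IsCellFamily (Nat.card G * n * (n + 1)) (B : Set A) (MatchedBetween g (B : Set A)
        (L.map (leftStep g (B : Set A))).prod ((L.map (rightStep g (B : Set A))).prod * 1)) {⟨(B : Set A), []⟩} := by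
      refine IsCellFamily.base ?_ _
      intro y₁ y₂ hy₁ hy₂ z hz w hw k
      rw [mul_one] at hw
      obtain ⟨l, rfl, hl, hlm⟩ := hpow _ hleft z hz
      obtain ⟨l', rfl, hl', hlm'⟩ := hpow _ hright w hw
      exact hg.prod_mul_mul_prod_mem_matchedValues (hlm k) (hlm' k) hl hl' hy₁ hy₂
    have h1 := hg.exists_isCellFamily_right (hsub _ hleft) L le_rfl hone hL ⟨_, hbase⟩
    rw [← one_mul (L.map (leftStep g (B : Set A))).prod] at h1
    obtain ⟨𝓕, h2⟩ := hg.exists_isCellFamily_left hone L (Nat.le_add_right _ _) hone hL h1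
    refine ⟨𝓕, h2.mono ?_ ?_⟩
    -- The bound satisfies `|G| n (n + 1) + 2 |G| (n + 1) = |G| (n + 1) (n + 2)`, one unit for each
    -- cut on either side.
    · rw [hlen]
      apply le_of_eq
      ring
    · intro u v h k
      simpa using h 1 rfl 1 rfl k

end

/-! ### From cells to separation -/

theorem mem_ULIndex_iff {k : ℕ} {L : Language A} :
    L ∈ ULIndex A k ↔ ∀ u v, ulSetoid A k u v → u ∈ L → v ∈ L := by
  constructor
  · rintro ⟨C, hC, hL⟩ u v huv hu
    obtain ⟨c, hc, huc⟩ := (hL u).1 hu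
    refine (hL v).2 ⟨c, hc, ?_⟩
    obtain ⟨w, rfl⟩ := hC hc
    exact (ulSetoid A k).trans ((ulSetoid A k).symm huv) huc
  · intro h
    refine ⟨{c | c ∈ (ulSetoid A k).classes ∧ ∃ u ∈ L, u ∈ c}, fun _ hc => hc.1, fun w => ?_⟩
    constructor
    · intro hw
      exact ⟨{u | ulSetoid A k u w}, ⟨⟨w, rfl⟩, w, hw, (ulSetoid A k).refl w⟩,
        (ulSetoid A k).refl w⟩
    · rintro ⟨_, ⟨⟨y, rfl⟩, u, hu, huy⟩, hwy⟩
      exact h u w ((ulSetoid A k).trans huy ((ulSetoid A k).symm hwy)) hu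

theorem unambiguousLanguages_subset_UL : unambiguousLanguages A ⊆ UL A := by
  rintro L ⟨S, hS, hSu, -, hL⟩
  obtain ⟨k, hk⟩ := (hS.image MarkedProduct.size).bddAbove
  refine Set.mem_iUnion.2 ⟨k, mem_ULIndex_iff.2 fun u v huv hu => ?_⟩
  obtain ⟨P, hP, huP⟩ := (hL u).1 hu
  exact (hL v).2 ⟨P, hP, (huv P (hSu P hP) (hk ⟨P, hP, rfl⟩)).1 huP⟩

theorem ulClosure_mem_ULIndex (k : ℕ) (L : Language A) : ulClosure k L ∈ ULIndex A k :=
  mem_ULIndex_iff.2 fun _ _ huv ⟨w, hw, hwu⟩ => ⟨w, hw, (ulSetoid A k).trans hwu huv⟩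

theorem le_ulClosure (k : ℕ) (L : Language A) : L ≤ ulClosure k L :=
  fun w hw => ⟨w, hw, (ulSetoid A k).refl w⟩

theorem separates_iff {L L₁ L₂ : Language A} :
    Separates L L₁ L₂ ↔ L₁ ≤ L ∧ ∀ w ∈ L₂, w ∉ L := by
  refine and_congr_right fun _ => ?_
  rw [← disjoint_iff]
  exact Set.disjoint_left

/-- Two recognized languages have a finite family of disjoint unambiguous products covering all
words such that, if a product of the family meets both languages, then for each `k` they contain
`≡_k`-equivalent words. -/
theorem exists_family_of_recognizedBy [Finite A] {M₁ M₂ : Type*} [Monoid M₁] [Finite M₁]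
    [Monoid M₂] [Finite M₂] {L₁ L₂ : Language A} (h₁ : RecognizedBy L₁ M₁)
    (h₂ : RecognizedBy L₂ M₂) {κ : ℕ}
    (hκ : Nat.card M₁ * Nat.card M₂ * Nat.card A * (Nat.card A + 1) ≤ κ) :
    ∃ 𝓕, IsCellFamily κ Set.univ (fun u v => u ∈ L₁ → v ∈ L₂ →
      ∀ k, ∃ u' ∈ L₁, ∃ v' ∈ L₂, ulSetoid A k u' v') 𝓕 := by
  obtain ⟨α₁, F₁, hF₁⟩ := h₁
  obtain ⟨α₂, F₂, hF₂⟩ := h₂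
  have := Fintype.ofFinite A
  have hg : IsPairHom (fun u v : List A =>
      (α₁ (FreeMonoid.ofList u), α₂ (FreeMonoid.ofList v))) :=
    ⟨by simp, fun u u' v v' => by simp⟩
  obtain ⟨𝓕, h⟩ := hg.exists_isCellFamily (Nat.card A) Finset.univ
    (by rw [Finset.card_univ, Nat.card_eq_fintype_card])
  rw [Finset.coe_univ, Nat.card_prod] at h
  refine ⟨𝓕, h.mono hκ fun u v huv hu hv k => ?_⟩
  obtain ⟨u', v', -, -, -, he, huv'⟩ := huv k
  rw [Prod.mk.injEq] at huv'
  exact ⟨u', (hF₁ u').2 (huv'.1 ▸ (hF₁ u).1 hu), v', (hF₂ v').2 (huv'.2 ▸ (hF₂ v).1 hv), he⟩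

end

theorem theorem4 {A : Type*} [Finite A] {M₁ M₂ : Type*} [Monoid M₁] [Finite M₁]
    [Monoid M₂] [Finite M₂] (L₁ L₂ : Language A)
    (h₁ : RecognizedBy L₁ M₁) (h₂ : RecognizedBy L₂ M₂)
    (κ : ℕ) (hκ : κ = (2 * Nat.card M₁ * Nat.card M₂ + 1) * (Nat.card A + 1) ^ 2) :
    List.TFAE [
      SeparableBy (unambiguousLanguages A) L₁ L₂,
      SeparableBy (UL A) L₁ L₂,
      SeparableBy (ULIndex A κ) L₁ L₂,
      Separates (ulClosure κ L₁) L₁ L₂] := by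
  obtain ⟨𝓕, h𝓕⟩ := exists_family_of_recognizedBy h₁ h₂ (κ := κ) (by rw [hκ]; nlinarith)
  tfae_have 1 → 2 := fun ⟨L, hL, h⟩ => ⟨L, unambiguousLanguages_subset_UL hL, h⟩
  tfae_have 2 → 4 := by
    rintro ⟨L, hL, hsep⟩
    obtain ⟨k, hL⟩ := Set.mem_iUnion.1 hL
    rw [separates_iff] at hsep ⊢
    refine ⟨le_ulClosure κ L₁, fun v hv ⟨u, hu, huv⟩ => ?_⟩
    -- By saturation `u` and `v` share a cell, so `L₁` and `L₂` contain `≡_k`-equivalent words for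
    -- the `k` of the given separator, however large.
    obtain ⟨P, hP, huP⟩ := h𝓕.cover u fun _ _ => Set.mem_univ _
    have hvP := h𝓕.mem_of_equiv P hP u huP v (fun _ _ => Set.mem_univ _)
      fun Q hQ hs _ => huv Q hQ hs
    obtain ⟨u', hu', v', hv', he⟩ := h𝓕.rel P hP u huP v hvP hu hv k
    exact hsep.2 v' hv' (mem_ULIndex_iff.1 hL u' v' he (hsep.1 hu'))
  tfae_have 4 → 3 := fun h => ⟨_, ulClosure_mem_ULIndex κ L₁, h⟩
  tfae_have 3 → 2 := fun ⟨L, hL, h⟩ => ⟨L, Set.mem_iUnion.2 ⟨κ, hL⟩, h⟩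
  tfae_have 4 → 1 := by
    intro h
    rw [separates_iff] at h
    -- The separator is the union of the cells that meet `L₁`.
    refine ⟨{w | ∃ P ∈ {P ∈ 𝓕 | ∃ u ∈ L₁, u ∈ P.language}, w ∈ P.language},
      ⟨_, h𝓕.finite.subset (Set.sep_subset _ _), fun P hP => h𝓕.unambiguous P hP.1, ?_,
        fun w => Iff.rfl⟩, ?_⟩
    · intro P hP Q hQ hne
      refine Set.disjoint_left.2 fun w hw hw' => hne (h𝓕.disjoint P hP.1 Q hQ.1 w hw hw')
    · refine separates_iff.2 ⟨?_, ?_⟩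
      · intro u hu
        obtain ⟨P, hP, huP⟩ := h𝓕.cover u fun _ _ => Set.mem_univ _
        exact ⟨P, ⟨hP, u, hu, huP⟩, huP⟩
      · rintro v hv ⟨P, ⟨hP, u, hu, huP⟩, hvP⟩
        obtain ⟨u', hu', v', hv', he⟩ := h𝓕.rel P hP u huP v hvP hu hv κ
        exact h.2 v' hv' ⟨u', hu', he⟩
  tfae_finish
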